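/- Let $L^2(\mathbb{C})$ be the Hilbert space of complex-valued functions on $\mathbb{C}\cong\mathbb{R}^2$ that are square-integrable with respect to Lebesgue measure, and let $\mathscr{H}\subset L^2(\mathbb{C})$ be the Bargmann--Fock space, i.e. the closed subspace of all square-integrable functions of the form $z\mapsto F(z)e^{-|z|^2/2}$ with $F:\mathbb{C}\to\mathbb{C}$ entire. Let $P:L^2(\mathbb{C})\to\mathscr{H}\subset L^2(\mathbb{C})$ be the orthogonal projection onto $\mathscr{H}$. For $f\in L^\infty(\mathbb{C})$, acting on $L^2(\mathbb{C})$ by pointwise multiplication, let $P_f:=PfP$ be the associated Fock--Toeplitz operator, regarded as a bounded operator on $L^2(\mathbb{C})$. A switch function is a non-decreasing measurable function $\Lambda:\mathbb{R}\to[0,1]$ for which there is an interval $[c,d]$ such that $\Lambda(x)=0$ for all $x<c$ and $\Lambda(x)=1$ for all $x>d$. Proposition. Let $\Lambda_1,\Lambda_2$ be arbitrary switch functions, and for $u=u_1+iu_2\in\mathbb{C}$ set $f_1(u):=\Lambda_1(u_1)$ and $f_2(u):=\Lambda_2(u_2)$. Then the commutator $[P_{f_1},P_{f_2}]=P_{f_1}P_{f_2}-P_{f_2}P_{f_1}$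 is trace class, and \[ \mathrm{Tr}[P_{f_1},P_{f_2}]=\frac{1}{2\pi i}. \] -/

import Mathlib

open MeasureTheory Set Filter Topology
open scoped ENNReal InnerProductSpace

namespace FockToeplitz

/-! ## Trace-class operators on a Hilbert space -/

section TraceClass

universe u

variable {E : Type u} [NormedAddCommGroup E] [InnerProductSpace ℂ E] [CompleteSpace E]

/-- A bounded operator `T` on a complex Hilbert space is trace class if its absolute value
`|T| = √(T* T)` has finite trace, i.e. the sum `∑ i, ⟪e i, |T| (e i)⟫` converges for every
orthonormal (Hilbert) basis `e` of the space. -/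
def IsTraceClass (T : E →L[ℂ] E) : Prop :=
  ∀ (ι : Type u) (e : HilbertBasis ι ℂ E),
    Summable fun i => ⟪e i, CFC.abs T (e i)⟫_ℂ

/-- `HasTrace T t`: the operator `T` is trace class, and its trace is `t`, i.e. for every
orthonormal (Hilbert) basis `e` of the space, `∑ i, ⟪e i, T (e i)⟫` converges
(unconditionally) to `t`. -/
def HasTrace (T : E →L[ℂ] E) (t : ℂ) : Prop :=
  IsTraceClass T ∧
    ∀ (ι : Type u) (e : HilbertBasis ι ℂ E), HasSum (fun i => ⟪e i, T (e i)⟫_ℂ) t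

end TraceClass

/-! ## The Bargmann–Fock space -/

/-- The Hilbert space `L²(ℂ)` of complex functions, for Lebesgue measure on `ℂ ≅ ℝ²`. -/
abbrev L2C : Type := Lp ℂ 2 (volume : Measure ℂ)

/-- The Gaussian weight `exp (-|z|² / 2)`. -/
noncomputable def gaussianWeight (z : ℂ) : ℂ := ((Real.exp (-‖z‖ ^ 2 / 2) : ℝ) : ℂ)

/-- The Bargmann–Fock space as a subspace of `L²(ℂ)`: the (classes of) square-integrable
functions of the form `z ↦ F z * exp (-|z|² / 2)` with `F` entire. -/
def fockSpace : Submodule ℂ L2C where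
  carrier := {φ | ∃ F : ℂ → ℂ, Differentiable ℂ F ∧
    (φ : ℂ → ℂ) =ᵐ[volume] fun z => F z * gaussianWeight z}
  zero_mem' := by
    refine ⟨0, differentiable_const 0, ?_⟩
    filter_upwards [Lp.coeFn_zero ℂ 2 (volume : Measure ℂ)] with z hz
    rw [hz]
    simp
  add_mem' := by
    rintro φ ψ ⟨F, hF, hφ⟩ ⟨G, hG, hψ⟩
    refine ⟨F + G, hF.add hG, ?_⟩
    filter_upwards [Lp.coeFn_add φ ψ, hφ, hψ] with z h h1 h2
    rw [h, Pi.add_apply, h1, h2, Pi.add_apply, add_mul]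
  smul_mem' := by
    rintro c φ ⟨F, hF, hφ⟩
    refine ⟨c • F, hF.const_smul c, ?_⟩
    filter_upwards [Lp.coeFn_smul c φ, hφ] with z h h1
    rw [h, Pi.smul_apply, h1, Pi.smul_apply, smul_mul_assoc]

/-- Mean value inequality over a unit disc, for an entire function. -/
theorem enorm_le_lintegral_ball {G : ℂ → ℂ} (hG : Differentiable ℂ G) (z : ℂ) :
    ‖G z‖ₑ ≤ ∫⁻ w in Metric.ball (0 : ℂ) 1, ‖G (z + w)‖ₑ := by
  have hGc : Continuous G := hG.continuous
  -- mean value inequality on circles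
  have hcirc : ∀ r : ℝ, ENNReal.ofReal (2 * Real.pi) * ‖G z‖ₑ ≤
      ∫⁻ θ in Ioo (-Real.pi) Real.pi,
        ‖G (z + r * (Real.cos θ + Real.sin θ * Complex.I))‖ₑ := by
    intro r
    have h1 : Real.circleAverage G z r = G z :=
      DiffContOnCl.circleAverage (hG.diffContOnCl)
    have hper : Function.Periodic (fun θ : ℝ => G (circleMap z r θ)) (2 * Real.pi) := by
      intro θ
      simp only [periodic_circleMap z r θ]
    have h2 : (∫ θ in Ioo (-Real.pi) Real.pi, G (circleMap z r θ)) =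
        (2 * Real.pi) • G z := by
      rw [← integral_Ioc_eq_integral_Ioo,
        ← intervalIntegral.integral_of_le (by linarith [Real.pi_pos])]
      have h3 := hper.intervalIntegral_add_eq (-Real.pi) 0
      rw [show -Real.pi + 2 * Real.pi = Real.pi by ring, zero_add] at h3
      rw [h3]
      have h4 := h1
      rw [Real.circleAverage_def] at h4
      rw [← h4, smul_smul, mul_inv_cancel₀ (by positivity), one_smul]
    calc ENNReal.ofReal (2 * Real.pi) * ‖G z‖ₑ
        = ‖(2 * Real.pi) • G z‖ₑ := by
          rw [enorm_smul, Real.enorm_eq_ofReal (by positivity)]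
      _ ≤ ∫⁻ θ in Ioo (-Real.pi) Real.pi, ‖G (circleMap z r θ)‖ₑ := by
          rw [← h2]; exact enorm_integral_le_lintegral_enorm _
      _ = _ := by
          refine lintegral_congr fun θ => ?_
          rw [circleMap, Complex.exp_mul_I, Complex.ofReal_cos, Complex.ofReal_sin]
  rw [← lintegral_indicator Metric.isOpen_ball.measurableSet,
    ← Complex.lintegral_comp_polarCoord_symm, polarCoord_target, Measure.volume_eq_prod,
    ← Measure.prod_restrict]
  have hm : Measurable fun p : ℝ × ℝ => ENNReal.ofReal p.1 •
      (Metric.ball (0 : ℂ) 1).indicator (fun w => ‖G (z + w)‖ₑ)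
        (Complex.polarCoord.symm p) := by
    have hmeas : Measurable fun w : ℂ =>
        (Metric.ball (0 : ℂ) 1).indicator (fun w => ‖G (z + w)‖ₑ) w :=
      (Measurable.indicator
        (hGc.measurable.comp (measurable_const_add z)).enorm Metric.isOpen_ball.measurableSet)
    have hp : Measurable fun p : ℝ × ℝ => Complex.polarCoord.symm p := by
      simp only [Complex.polarCoord_symm_apply]
      fun_prop
    exact (ENNReal.measurable_ofReal.comp measurable_fst).smul (hmeas.comp hp)
  rw [lintegral_prod _ hm.aemeasurable]
  have hsub : Ioo (1 / 2 : ℝ) 1 ⊆ Ioi 0 := fun x hx => lt_trans (by norm_num) hx.1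
  calc ‖G z‖ₑ ≤ ∫⁻ r in Ioo (1 / 2 : ℝ) 1,
        ENNReal.ofReal (1 / 2) * (ENNReal.ofReal (2 * Real.pi) * ‖G z‖ₑ) := by
        rw [setLIntegral_const, Real.volume_Ioo, mul_comm, ← mul_assoc, ← mul_assoc,
          ← ENNReal.ofReal_mul (by norm_num), ← ENNReal.ofReal_mul (by norm_num)]
        refine le_mul_of_one_le_left zero_le ?_
        rw [ENNReal.one_le_ofReal]
        linarith [Real.pi_gt_three]
    _ ≤ ∫⁻ r in Ioo (1 / 2 : ℝ) 1, ∫⁻ θ in Ioo (-Real.pi) Real.pi,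
        ENNReal.ofReal r • (Metric.ball (0 : ℂ) 1).indicator (fun w => ‖G (z + w)‖ₑ)
          (Complex.polarCoord.symm (r, θ)) := by
        refine setLIntegral_mono' measurableSet_Ioo fun r hr => ?_
        have hball : ∀ θ : ℝ, Complex.polarCoord.symm (r, θ) ∈ Metric.ball (0 : ℂ) 1 := by
          intro θ
          rw [mem_ball_zero_iff, Complex.norm_polarCoord_symm, abs_lt]
          exact ⟨by linarith [hr.1], hr.2⟩
        simp only [indicator_of_mem (hball _), smul_eq_mul]
        rw [lintegral_const_mul']
        · refine mul_le_mul' (ENNReal.ofReal_le_ofReal hr.1.le) ?_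
          simpa [Complex.polarCoord_symm_apply] using hcirc r
        · exact ENNReal.ofReal_ne_top
    _ ≤ _ := lintegral_mono_set hsub

/-- Evaluation of the entire factor is bounded on the Fock space, locally uniformly. -/
theorem norm_le_of_fock {φ : L2C} {F : ℂ → ℂ} (hF : Differentiable ℂ F)
    (hφ : (φ : ℂ → ℂ) =ᵐ[volume] fun z => F z * gaussianWeight z) (z : ℂ) :
    ‖F z‖ ≤ Real.exp ((‖z‖ + 1) ^ 2 / 2) * ‖φ‖ := by
  have h1 := enorm_le_lintegral_ball (hF.pow 2) z
  have h2 : ∀ w ∈ Metric.ball (0 : ℂ) 1, ‖(F ^ 2) (z + w)‖ₑ ≤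
      ENNReal.ofReal (Real.exp ((‖z‖ + 1) ^ 2)) *
        ‖F (z + w) * gaussianWeight (z + w)‖ₑ ^ 2 := by
    intro w hw
    rw [mem_ball_zero_iff] at hw
    have hle : ‖z + w‖ ≤ ‖z‖ + 1 := (norm_add_le z w).trans (by linarith)
    have hreal : ‖(F ^ 2) (z + w)‖ ≤ Real.exp ((‖z‖ + 1) ^ 2) *
        ‖F (z + w) * gaussianWeight (z + w)‖ ^ 2 := by
      have hg : ‖gaussianWeight (z + w)‖ ^ 2 = Real.exp (-‖z + w‖ ^ 2) := by
        rw [gaussianWeight, Complex.norm_real, Real.norm_of_nonneg (Real.exp_pos _).le,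
          ← Real.exp_nat_mul]
        congr 1; push_cast; ring
      rw [Pi.pow_apply, norm_pow, norm_mul, mul_pow, hg]
      have : 1 ≤ Real.exp ((‖z‖ + 1) ^ 2) * Real.exp (-‖z + w‖ ^ 2) := by
        rw [← Real.exp_add]
        apply Real.one_le_exp
        nlinarith [norm_nonneg (z + w)]
      nlinarith [sq_nonneg ‖F (z + w)‖]
    rw [← ofReal_norm, ← ofReal_norm, ← ENNReal.ofReal_pow (norm_nonneg _),
      ← ENNReal.ofReal_mul (Real.exp_pos _).le]
    exact ENNReal.ofReal_le_ofReal hreal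
  have h3 : ‖F z‖ₑ ^ 2 ≤ ENNReal.ofReal (Real.exp ((‖z‖ + 1) ^ 2)) * ‖φ‖ₑ ^ 2 := by
    calc ‖F z‖ₑ ^ 2 = ‖(F ^ 2) z‖ₑ := by simp
      _ ≤ _ := h1
      _ ≤ ∫⁻ w in Metric.ball (0 : ℂ) 1, ENNReal.ofReal (Real.exp ((‖z‖ + 1) ^ 2)) *
          ‖F (z + w) * gaussianWeight (z + w)‖ₑ ^ 2 :=
        setLIntegral_mono' Metric.isOpen_ball.measurableSet h2
      _ ≤ ∫⁻ w, ENNReal.ofReal (Real.exp ((‖z‖ + 1) ^ 2)) *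
          ‖F (z + w) * gaussianWeight (z + w)‖ₑ ^ 2 := setLIntegral_le_lintegral _ _
      _ = ENNReal.ofReal (Real.exp ((‖z‖ + 1) ^ 2)) *
          ∫⁻ w, ‖F w * gaussianWeight w‖ₑ ^ 2 := by
        rw [lintegral_const_mul' _ _ ENNReal.ofReal_ne_top,
          lintegral_add_left_eq_self (fun w => ‖F w * gaussianWeight w‖ₑ ^ 2) z]
      _ = _ := by
        congr 1
        rw [Lp.enorm_def, eLpNorm_eq_lintegral_rpow_enorm_toReal (by norm_num) (by norm_num)]
        have : ∫⁻ w, ‖F w * gaussianWeight w‖ₑ ^ 2 = ∫⁻ w, ‖φ w‖ₑ ^ (2 : ℝ) := by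
          refine lintegral_congr_ae ?_
          filter_upwards [hφ] with w hw
          rw [hw]; norm_cast
        rw [this, ← ENNReal.rpow_natCast, ← ENNReal.rpow_mul]
        simp
  have h4 : ‖F z‖ ^ 2 ≤ Real.exp ((‖z‖ + 1) ^ 2) * ‖φ‖ ^ 2 := by
    rw [← ofReal_norm, ← ofReal_norm, ← ENNReal.ofReal_pow (norm_nonneg _),
      ← ENNReal.ofReal_pow (norm_nonneg _), ← ENNReal.ofReal_mul (Real.exp_pos _).le] at h3
    exact (ENNReal.ofReal_le_ofReal_iff (by positivity)).1 h3
  refine le_of_sq_le_sq ?_ (by positivity)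
  rw [mul_pow, ← Real.exp_nat_mul]
  have h5 : ((2 : ℕ) : ℝ) * ((‖z‖ + 1) ^ 2 / 2) = (‖z‖ + 1) ^ 2 := by
    push_cast; ring
  rw [h5]
  exact h4

/-- The Bargmann–Fock space is closed in `L²(ℂ)`. -/
theorem isClosed_fockSpace : IsClosed (fockSpace : Set L2C) := by
  refine IsSeqClosed.isClosed ?_
  intro φ ψ hφ hlim
  choose F hF hφF using hφ
  have hdiff : ∀ m n z, ‖F m z - F n z‖ ≤
      Real.exp ((‖z‖ + 1) ^ 2 / 2) * ‖φ m - φ n‖ := by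
    intro m n z
    refine norm_le_of_fock (φ := φ m - φ n) (F := F m - F n) ((hF m).sub (hF n)) ?_ z
    filter_upwards [Lp.coeFn_sub (φ m) (φ n), hφF m, hφF n] with w h h1 h2
    rw [h, Pi.sub_apply, h1, h2, Pi.sub_apply, sub_mul]
  have hcauchy : ∀ z, CauchySeq fun n => F n z := by
    intro z
    have hc := hlim.cauchySeq
    rw [Metric.cauchySeq_iff] at hc ⊢
    intro ε hε
    have hpos := Real.exp_pos ((‖z‖ + 1) ^ 2 / 2)
    obtain ⟨N, hN⟩ := hc (ε / Real.exp ((‖z‖ + 1) ^ 2 / 2)) (by positivity)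
    refine ⟨N, fun m hm n hn => ?_⟩
    have := hN m hm n hn
    rw [dist_eq_norm, lt_div_iff₀ hpos] at this
    rw [dist_eq_norm]
    exact (hdiff m n z).trans_lt (by linarith)
  choose G hG using fun z => cauchySeq_tendsto_of_complete (hcauchy z)
  have hbound : ∀ n z, ‖G z - F n z‖ ≤ Real.exp ((‖z‖ + 1) ^ 2 / 2) * ‖ψ - φ n‖ := by
    intro n z
    refine le_of_tendsto_of_tendsto' ((hG z).sub_const (F n z)).norm
      (((hlim.sub_const (φ n)).norm).const_mul _) fun m => hdiff m n z
  have hunif : TendstoLocallyUniformlyOn F G atTop univ := by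
    rw [Metric.tendstoLocallyUniformlyOn_iff]
    intro ε hε z _
    set C := Real.exp ((‖z‖ + 2) ^ 2 / 2) with hC
    have hCpos : 0 < C := Real.exp_pos _
    refine ⟨Metric.ball z 1, mem_nhdsWithin_of_mem_nhds (Metric.ball_mem_nhds z one_pos), ?_⟩
    obtain ⟨N, hN⟩ := (Metric.tendsto_atTop.1 hlim) (ε / C) (by positivity)
    filter_upwards [eventually_ge_atTop N] with n hn y hy
    have h1 := hN n hn
    rw [dist_comm, dist_eq_norm, lt_div_iff₀ hCpos] at h1
    rw [dist_eq_norm]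
    have hy1 : ‖y‖ ≤ ‖z‖ + 1 := by
      rw [Metric.mem_ball, dist_eq_norm] at hy
      have := norm_add_le z (y - z)
      rw [add_sub_cancel] at this
      linarith
    have h2 : Real.exp ((‖y‖ + 1) ^ 2 / 2) ≤ C := by
      apply Real.exp_le_exp.2
      nlinarith [norm_nonneg y, norm_nonneg z]
    calc ‖G y - F n y‖ ≤ _ := hbound n y
      _ ≤ C * ‖ψ - φ n‖ := by gcongr
      _ < ε := by linarith
  refine ⟨G, ?_, ?_⟩
  · rw [← differentiableOn_univ]
    exact hunif.differentiableOn (Eventually.of_forall fun n => (hF n).differentiableOn) isOpen_univ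
  · obtain ⟨ns, hns, hae⟩ :=
      (tendstoInMeasure_of_tendsto_Lp hlim).exists_seq_tendsto_ae
    have hall : ∀ᵐ z, ∀ n, φ n z = F n z * gaussianWeight z := ae_all_iff.2 hφF
    filter_upwards [hae, hall] with z h1 h2
    simp only [h2] at h1
    exact tendsto_nhds_unique h1
      (((hG z).comp hns.tendsto_atTop).mul_const (gaussianWeight z))

instance : CompleteSpace fockSpace :=
  isClosed_fockSpace.completeSpace_coe

/-- The orthogonal projection `P` of `L²(ℂ)` onto the Bargmann–Fock space, viewed as a bounded
operator on `L²(ℂ)`. -/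
noncomputable def fockProjection : L2C →L[ℂ] L2C := fockSpace.starProjection

/-! ## Fock–Toeplitz operators -/

/-- The operator of pointwise multiplication by `f ∈ L^∞(ℂ)` on `L²(ℂ)`. -/
noncomputable def mulOp (f : Lp ℂ ∞ (volume : Measure ℂ)) : L2C →L[ℂ] L2C :=
  (ContinuousLinearMap.mul ℂ ℂ).holderL volume ∞ 2 2 f

theorem mulOp_coeFn (f : Lp ℂ ∞ (volume : Measure ℂ)) (φ : L2C) :
    (mulOp f φ : ℂ → ℂ) =ᵐ[volume] fun z => f z * φ z :=
  (ContinuousLinearMap.mul ℂ ℂ).coeFn_holder f φ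

/-- The Fock–Toeplitz operator `P_f = P f P`, as a bounded operator on `L²(ℂ)`. -/
noncomputable def fockToeplitz (f : Lp ℂ ∞ (volume : Measure ℂ)) : L2C →L[ℂ] L2C :=
  fockProjection ∘L mulOp f ∘L fockProjection

/-! ## Switch functions -/

/-- A switch function: a non-decreasing measurable function `Λ : ℝ → [0, 1]` which, for some
interval `[c, d]`, vanishes to the left of `c` and equals `1` to the right of `d`. -/
structure IsSwitchFunction (Λ : ℝ → ℝ) : Prop where
  monotone : Monotone Λ
  measurable : Measurable Λ
  mem_Icc : ∀ x, Λ x ∈ Icc (0 : ℝ) 1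
  exists_interval : ∃ c d : ℝ, c ≤ d ∧ (∀ x, x < c → Λ x = 0) ∧ (∀ x, d < x → Λ x = 1)

/-- A switch function of a measurable real coordinate `x` on `ℂ` is in `L^∞(ℂ)`. -/
theorem IsSwitchFunction.memLp {Λ : ℝ → ℝ} (h : IsSwitchFunction Λ) {x : ℂ → ℝ}
    (hx : Measurable x) :
    MemLp (fun u : ℂ => ((Λ (x u) : ℝ) : ℂ)) ∞ (volume : Measure ℂ) := by
  refine memLp_top_of_bound
    (Complex.measurable_ofReal.comp (h.measurable.comp hx)).aestronglyMeasurable 1 ?_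
  refine Eventually.of_forall fun u => ?_
  rw [Complex.norm_real, Real.norm_of_nonneg (h.mem_Icc _).1]
  exact (h.mem_Icc _).2

/-- The function `u = u₁ + i u₂ ↦ Λ u₁`, as an element of `L^∞(ℂ)`. -/
noncomputable def IsSwitchFunction.fst {Λ : ℝ → ℝ} (h : IsSwitchFunction Λ) :
    Lp ℂ ∞ (volume : Measure ℂ) :=
  (h.memLp Complex.measurable_re).toLp fun u : ℂ => ((Λ u.re : ℝ) : ℂ)

/-- The function `u = u₁ + i u₂ ↦ Λ u₂`, as an element of `L^∞(ℂ)`. -/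
noncomputable def IsSwitchFunction.snd {Λ : ℝ → ℝ} (h : IsSwitchFunction Λ) :
    Lp ℂ ∞ (volume : Measure ℂ) :=
  (h.memLp Complex.measurable_im).toLp fun u : ℂ => ((Λ u.im : ℝ) : ℂ)

end FockToeplitz

/-! For real symbols, with Hankel operators `H_f = (1 - P) f P`, one has `H_g* H_f = P g f P - P_g
P_f`. Multiplications commute, so `[P_f, P_g] = H_g* H_f - H_f* H_g` (`commutator_fockToeplitz_eq`),
and each product turns out to be trace class by itself.

With `k_v` the coherent state at `v`, `(H_f φ)(v) = ⟪α_v, φ⟫` for `α_v = P((f(v) - f) k_v)`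
(`hankel_coeFn`). Let `β_v` be the same vector for `g`. Then `H_g* H_f` is the weak integral over
`v` of the rank-one operators `|β_v⟩⟨α_v|`. The kernel decays like a Gaussian off the diagonal, so
`α_v` is small when `v.re` is far from the transition interval of `Λ₁`, and `β_v` when `v.im` is far
from that of `Λ₂`. Hence `‖α_v‖ ‖β_v‖` is integrable over the plane. This gives the trace class
property (`nuclearBound_of_integral`) and the trace `∫ ⟪α_v, β_v⟫` (`hasSum_of_integral`).

By translation, `⟪α_v, β_v⟫` is an integral over `a, b` of increments of the switch functions
against a kernel independent of `v` (`inner_hankelVector`). Integrating over `v` first uses `∫ (Λ s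
- Λ (t + s)) ds = -t`, so the switch functions disappear and the factor `a.re * b.im` remains. Its
Gaussian moment gives `∫ ⟪α_v, β_v⟫ = -i/(4π)`. Subtracting the complex conjugate yields `-i/(2π) =
1/(2πi)`. -/

namespace FockToeplitz

open scoped ComplexConjugate

universe u

/-! ### Trace class from bounds on matrix coefficients -/

section NuclearBound

variable {E : Type u} [NormedAddCommGroup E] [InnerProductSpace ℂ E]

/-- `C` bounds the sums `∑ ‖⟪U e i, T e i⟫‖`, for all contractions `U` and all Hilbert bases. -/
def NuclearBound (T : E →L[ℂ] E) (C : ℝ) : Prop :=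
  ∀ U : E →L[ℂ] E, ‖U‖ ≤ 1 → ∀ (ι : Type u) (e : HilbertBasis ι ℂ E) (s : Finset ι),
    ∑ i ∈ s, ‖⟪U (e i), T (e i)⟫_ℂ‖ ≤ C

theorem NuclearBound.sub {S T : E →L[ℂ] E} {C D : ℝ} (hS : NuclearBound S C)
    (hT : NuclearBound T D) : NuclearBound (S - T) (C + D) := by
  intro U hU ι e s
  refine le_trans ?_ (add_le_add (hS U hU ι e s) (hT U hU ι e s))
  rw [← Finset.sum_add_distrib]
  refine Finset.sum_le_sum fun i _ => ?_
  rw [_root_.sub_apply, inner_sub_right]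
  exact norm_sub_le _ _

variable [CompleteSpace E]

/-- A regularised polar decomposition of a bounded operator. -/
theorem exists_contraction_abs_approx (T : E →L[ℂ] E) {ε : ℝ} (hε : 0 < ε) :
    ∃ U : E →L[ℂ] E, ‖U‖ ≤ 1 ∧
      ∀ x, ‖⟪x, CFC.abs T x⟫_ℂ - ⟪U x, T x⟫_ℂ‖ ≤ ε * ‖x‖ ^ 2 := by
  set S : E →L[ℂ] E := CFC.abs T with hSdef
  have hS0 : 0 ≤ S := CFC.abs_nonneg T
  have hpos : S.IsPositive := (ContinuousLinearMap.nonneg_iff_isPositive S).1 hS0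
  have hTS : ∀ x y, ⟪T x, T y⟫_ℂ = ⟪S x, S y⟫_ℂ := by
    intro x y
    have h : S * S = star T * T := CFC.abs_mul_abs T
    have h1 : (S * S) y = (star T * T) y := by rw [h]
    rw [mul_apply_eq_comp, mul_apply_eq_comp,
      ContinuousLinearMap.star_eq_adjoint] at h1
    rw [← ContinuousLinearMap.adjoint_inner_right, ← h1]
    exact (hpos.isSymmetric x (S y)).symm
  -- The spectrum of `S ≥ 0` avoids `-ε`, so `S + ε` is invertible; `R` is its inverse.
  have hunit : IsUnit (algebraMap ℝ (E →L[ℂ] E) (-ε) - S) := by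
    by_contra h
    have := spectrum_nonneg_of_nonneg hS0 (x := -ε) h
    linarith
  obtain ⟨u, hu⟩ := hunit.neg
  set R : E →L[ℂ] E := ↑u⁻¹
  have hR : ∀ x, S (R x) + ε • R x = x := by
    intro x
    have h : (u : E →L[ℂ] E) * R = 1 := u.mul_inv
    have h1 := congrArg (fun A : E →L[ℂ] E => A x) h
    rw [hu, Algebra.algebraMap_eq_smul_one] at h1
    simp at h1
    rw [add_comm]
    simpa [add_comm] using h1
  have hSR : ∀ x, ‖S (R x)‖ ≤ ‖x‖ := by
    -- Expand the square of `x = S (R x) + ε R x`; the cross term is nonnegative since `S ≥ 0`.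
    intro x
    have h1 : ‖x‖ ^ 2 = ‖S (R x)‖ ^ 2 + 2 * (ε * RCLike.re ⟪S (R x), R x⟫_ℂ) +
        ‖ε • R x‖ ^ 2 := by
      conv_lhs => rw [← hR x]
      rw [norm_add_sq (𝕜 := ℂ), inner_smul_right_eq_smul]
      simp
    have h2 := hpos.re_inner_nonneg_left (R x)
    refine le_of_sq_le_sq ?_ (norm_nonneg _)
    rw [h1]
    have := mul_nonneg hε.le h2
    nlinarith [sq_nonneg ‖ε • R x‖]
  -- `U = T (|T| + ε)⁻¹` stands in for the partial isometry of the polar decomposition. The error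
  -- `⟪x - S (R x), S x⟫` equals `ε ⟪S (R x), x⟫`.
  refine ⟨T ∘L R, ?_, fun x => ?_⟩
  · refine ContinuousLinearMap.opNorm_le_bound _ zero_le_one fun x => ?_
    rw [one_mul, ContinuousLinearMap.comp_apply]
    refine le_trans (le_of_eq ?_) (hSR x)
    rw [norm_eq_sqrt_re_inner (𝕜 := ℂ), hTS, ← norm_eq_sqrt_re_inner]
  · rw [ContinuousLinearMap.comp_apply, hTS, ← inner_sub_left]
    have h1 : x - S (R x) = ε • R x := by
      nth_rewrite 1 [← hR x]
      rw [add_sub_cancel_left]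
    have h2 : ⟪x - S (R x), S x⟫_ℂ = ε • ⟪S (R x), x⟫_ℂ := by
      rw [h1, inner_smul_left_eq_smul]
      congr 1
      exact (hpos.isSymmetric (R x) x).symm
    rw [h2, norm_smul, Real.norm_of_nonneg hε.le]
    have := norm_inner_le_norm (𝕜 := ℂ) (S (R x)) x
    have := mul_le_mul_of_nonneg_right (hSR x) (norm_nonneg x)
    gcongr
    nlinarith

/-- The contraction `U` in `NuclearBound` is there to be the approximate polar part of `T`, which
turns `⟪U e, T e⟫` into `⟪e, |T| e⟫` up to an arbitrarily small error. -/
theorem NuclearBound.isTraceClass {T : E →L[ℂ] E} {C : ℝ} (hT : NuclearBound T C) :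
    IsTraceClass T := by
  intro ι e
  refine Summable.of_norm (summable_of_sum_le (c := C) (fun i => norm_nonneg _) fun s => ?_)
  refine le_of_forall_pos_le_add fun δ hδ => ?_
  -- The errors over `s` must add up to at most `δ`; the `+ 1` covers empty `s`.
  obtain ⟨U, hU, hUT⟩ := exists_contraction_abs_approx T
    (show 0 < δ / (s.card + 1) by positivity)
  have h1 : ∀ i, ‖⟪e i, CFC.abs T (e i)⟫_ℂ‖ ≤ ‖⟪U (e i), T (e i)⟫_ℂ‖ + δ / (s.card + 1) := by
    intro i
    have h := hUT (e i)
    rw [e.orthonormal.1 i, one_pow, mul_one] at h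
    have := norm_le_norm_add_norm_sub' ⟪e i, CFC.abs T (e i)⟫_ℂ ⟪U (e i), T (e i)⟫_ℂ
    linarith
  calc _ ≤ ∑ i ∈ s, (‖⟪U (e i), T (e i)⟫_ℂ‖ + δ / (s.card + 1)) :=
        Finset.sum_le_sum fun i _ => h1 i
    _ ≤ C + δ := by
        rw [Finset.sum_add_distrib, Finset.sum_const, nsmul_eq_mul]
        refine add_le_add (hT U hU ι e s) ?_
        rw [mul_div_assoc', div_le_iff₀ (by positivity)]
        nlinarith

end NuclearBound

/-- Cauchy–Schwarz followed by Bessel's inequality for each factor. -/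
theorem sum_norm_inner_mul_le {E ι : Type*} [NormedAddCommGroup E] [InnerProductSpace ℂ E]
    {e : ι → E} (he : Orthonormal ℂ e) (s : Finset ι) (x y : E) :
    ∑ i ∈ s, ‖⟪e i, x⟫_ℂ‖ * ‖⟪e i, y⟫_ℂ‖ ≤ ‖x‖ * ‖y‖ := by
  refine (Real.sum_mul_le_sqrt_mul_sqrt s _ _).trans ?_
  refine mul_le_mul ?_ ?_ (Real.sqrt_nonneg _) (norm_nonneg _)
  · exact (Real.sqrt_le_left (norm_nonneg _)).2 (he.sum_inner_products_le x)
  · exact (Real.sqrt_le_left (norm_nonneg _)).2 (he.sum_inner_products_le y)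

theorem countable_of_orthonormal {E ι : Type*} [NormedAddCommGroup E] [InnerProductSpace ℂ E]
    [TopologicalSpace.SeparableSpace E] {e : ι → E} (he : Orthonormal ℂ e) : Countable ι := by
  rw [← countable_univ_iff]
  refine PairwiseDisjoint.countable_of_isOpen (s := fun i => Metric.ball (e i) (1 / 2)) ?_
    (fun i _ => Metric.isOpen_ball) fun i _ => ⟨e i, Metric.mem_ball_self (by norm_num)⟩
  intro i _ j _ hij
  refine Metric.ball_disjoint_ball ?_
  -- Distinct orthonormal vectors are `√2` apart, so balls of radius `1/2` are disjoint.
  have h1 : ‖e i - e j‖ ^ 2 = 2 := by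
    rw [norm_sub_sq (𝕜 := ℂ), he.2 hij, he.1 i, he.1 j]
    norm_num
  rw [dist_eq_norm]
  nlinarith [norm_nonneg (e i - e j)]

/-! ### Weak integrals of rank-one operators -/

section WeakIntegral

variable {E : Type u} [NormedAddCommGroup E] [InnerProductSpace ℂ E]
  {X : Type*} [MeasurableSpace X] {μ : Measure X} {T : E →L[ℂ] E} {a b : X → E} {g : X → ℝ}

theorem integrable_inner_mul_inner
    (ha : ∀ x, AEStronglyMeasurable (fun v => ⟪a v, x⟫_ℂ) μ)
    (hb : ∀ x, AEStronglyMeasurable (fun v => ⟪b v, x⟫_ℂ) μ)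
    (hg : Integrable g μ) (hab : ∀ v, ‖a v‖ * ‖b v‖ ≤ g v) (x y : E) :
    Integrable (fun v => ⟪x, a v⟫_ℂ * ⟪b v, y⟫_ℂ) μ := by
  have ha' : AEStronglyMeasurable (fun v => ⟪x, a v⟫_ℂ) μ := by
    simpa only [Function.comp_def, inner_conj_symm] using
      Complex.continuous_conj.comp_aestronglyMeasurable (ha x)
  refine ((hg.const_mul ‖x‖).mul_const ‖y‖).mono' (ha'.mul (hb y)) (Eventually.of_forall fun v => ?_)
  rw [norm_mul]
  calc _ ≤ (‖x‖ * ‖a v‖) * (‖b v‖ * ‖y‖) :=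
        mul_le_mul (norm_inner_le_norm _ _) (norm_inner_le_norm _ _) (norm_nonneg _) (by positivity)
    _ = ‖x‖ * (‖a v‖ * ‖b v‖) * ‖y‖ := by ring
    _ ≤ _ := by gcongr; exact hab v

/-- The trace norm of `∫ |a v⟩⟨b v|` is at most `∫ ‖a v‖ ‖b v‖`: the adjoint of `U` acts on `a v`
without increasing its norm, and `sum_norm_inner_mul_le` applies for each `v`. -/
theorem nuclearBound_of_integral [CompleteSpace E]
    (ha : ∀ x, AEStronglyMeasurable (fun v => ⟪a v, x⟫_ℂ) μ)
    (hb : ∀ x, AEStronglyMeasurable (fun v => ⟪b v, x⟫_ℂ) μ)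
    (hg : Integrable g μ) (hab : ∀ v, ‖a v‖ * ‖b v‖ ≤ g v)
    (hT : ∀ x y, ⟪x, T y⟫_ℂ = ∫ v, ⟪x, a v⟫_ℂ * ⟪b v, y⟫_ℂ ∂μ) :
    NuclearBound T (∫ v, g v ∂μ) := by
  intro U hU ι e s
  have hint := integrable_inner_mul_inner ha hb hg hab
  calc ∑ i ∈ s, ‖⟪U (e i), T (e i)⟫_ℂ‖
      ≤ ∑ i ∈ s, ∫ v, ‖⟪U (e i), a v⟫_ℂ * ⟪b v, e i⟫_ℂ‖ ∂μ := by
        refine Finset.sum_le_sum fun i _ => ?_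
        rw [hT]
        exact norm_integral_le_integral_norm _
    _ = ∫ v, ∑ i ∈ s, ‖⟪U (e i), a v⟫_ℂ * ⟪b v, e i⟫_ℂ‖ ∂μ :=
        (integral_finsetSum s fun i _ => (hint _ _).norm).symm
    _ ≤ ∫ v, g v ∂μ := by
        refine integral_mono (integrable_finsetSum s fun i _ => (hint _ _).norm) hg fun v => ?_
        refine le_trans ?_ (hab v)
        have h1 : ‖ContinuousLinearMap.adjoint U (a v)‖ ≤ ‖a v‖ := by
          refine (ContinuousLinearMap.le_opNorm _ _).trans ?_
          rw [LinearIsometryEquiv.norm_map]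
          exact mul_le_of_le_one_left (norm_nonneg _) hU
        refine le_trans ?_ (mul_le_mul_of_nonneg_right h1 (norm_nonneg _))
        refine le_trans (le_of_eq ?_) (sum_norm_inner_mul_le e.orthonormal s _ _)
        refine Finset.sum_congr rfl fun i _ => ?_
        rw [norm_mul, ContinuousLinearMap.adjoint_inner_right, norm_inner_symm (b v)]

/-- The rank-one operator `|a v⟩⟨b v|` has trace `⟪b v, a v⟫` by Parseval. The domination by `g`
allows the sum over the basis, countable by separability, to be exchanged with the integral. -/
theorem hasSum_of_integral [TopologicalSpace.SeparableSpace E]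
    (ha : ∀ x, AEStronglyMeasurable (fun v => ⟪a v, x⟫_ℂ) μ)
    (hb : ∀ x, AEStronglyMeasurable (fun v => ⟪b v, x⟫_ℂ) μ)
    (hg : Integrable g μ) (hab : ∀ v, ‖a v‖ * ‖b v‖ ≤ g v)
    (hT : ∀ x y, ⟪x, T y⟫_ℂ = ∫ v, ⟪x, a v⟫_ℂ * ⟪b v, y⟫_ℂ ∂μ)
    {ι : Type*} (e : HilbertBasis ι ℂ E) :
    HasSum (fun i => ⟪e i, T (e i)⟫_ℂ) (∫ v, ⟪b v, a v⟫_ℂ ∂μ) := by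
  have := countable_of_orthonormal e.orthonormal
  have hint := integrable_inner_mul_inner ha hb hg hab
  have h := hasSum_integral_of_summable_integral_norm (μ := μ)
    (F := fun i v => ⟪e i, a v⟫_ℂ * ⟪b v, e i⟫_ℂ) (fun i => hint _ _) ?_
  · simp only [hT]
    have h2 : (fun v => ⟪b v, a v⟫_ℂ) = fun v => ∑' i, ⟪e i, a v⟫_ℂ * ⟪b v, e i⟫_ℂ := by
      funext v
      rw [← e.tsum_inner_mul_inner]
      simp only [mul_comm]
    rw [h2]
    exact h
  · refine summable_of_sum_le (c := ∫ v, g v ∂μ) (fun i => integral_nonneg fun v => norm_nonneg _)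
      fun s => ?_
    rw [← integral_finsetSum s fun i _ => (hint _ _).norm]
    refine integral_mono (integrable_finsetSum s fun i _ => (hint _ _).norm) hg fun v => ?_
    refine le_trans (le_of_eq ?_) ((sum_norm_inner_mul_le e.orthonormal s (a v) (b v)).trans (hab v))
    refine Finset.sum_congr rfl fun i _ => ?_
    rw [norm_mul, norm_inner_symm (b v)]

end WeakIntegral

/-! ### Gaussian integrals over the plane -/

theorem cexp_neg_mul_conj (z : ℂ) :
    Complex.exp (-(z * conj z)) = ((Real.exp (-‖z‖ ^ 2) : ℝ) : ℂ) := by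
  rw [Complex.mul_conj, Complex.normSq_eq_norm_sq]
  push_cast
  rfl

theorem integrable_exp_neg_mul_norm_sq {c : ℝ} (hc : 0 < c) :
    Integrable fun z : ℂ => Real.exp (-c * ‖z‖ ^ 2) := by
  have h := (GaussianFourier.integrable_cexp_neg_mul_sq_norm_add (V := ℂ) (b := c)
    (by simpa using hc) 0 0).norm
  refine h.congr (Eventually.of_forall fun z => ?_)
  simp only [Complex.norm_exp]
  congr 1
  norm_cast
  simp

theorem integrable_add_norm_pow_mul_exp {c : ℝ} (hc : 0 < c) (R : ℝ) (hR : 0 ≤ R) (k : ℕ) :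
    Integrable fun z : ℂ => (R + ‖z‖) ^ k * Real.exp (-c * ‖z‖ ^ 2) := by
  refine ((integrable_exp_neg_mul_norm_sq (half_pos hc)).const_mul
    (k.factorial * Real.exp (R + 1 / (2 * c)))).mono' (by fun_prop)
    (Eventually.of_forall fun z => ?_)
  have h0 := norm_nonneg z
  rw [Real.norm_of_nonneg (by positivity)]
  have h1 : (R + ‖z‖) ^ k ≤ k.factorial * Real.exp (R + ‖z‖) := by
    have := Real.pow_div_factorial_le_exp (R + ‖z‖) (by positivity) k
    rwa [div_le_iff₀ (by positivity), mul_comm] at this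
  calc _ ≤ k.factorial * Real.exp (R + ‖z‖) * Real.exp (-c * ‖z‖ ^ 2) := by gcongr
    _ = k.factorial * Real.exp (R + ‖z‖ + -c * ‖z‖ ^ 2) := by rw [mul_assoc, Real.exp_add (R + ‖z‖)]
    _ ≤ k.factorial * Real.exp (R + 1 / (2 * c) + -(c / 2) * ‖z‖ ^ 2) := by
      refine mul_le_mul_of_nonneg_left (Real.exp_le_exp.2 ?_) (by positivity)
      -- Completing the square: half of the Gaussian absorbs `exp ‖z‖` at the cost of the constant
      -- `1 / (2 * c)`.
      have : R + 1 / (2 * c) + -(c / 2) * ‖z‖ ^ 2 - (R + ‖z‖ + -c * ‖z‖ ^ 2) =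
          (c * ‖z‖ - 1) ^ 2 / (2 * c) := by field_simp; ring
      have : 0 ≤ (c * ‖z‖ - 1) ^ 2 / (2 * c) := by positivity
      linarith
    _ = _ := by rw [mul_assoc, Real.exp_add (R + 1 / (2 * c))]

theorem integral_cexp_neg_mul_conj : ∫ z : ℂ, Complex.exp (-(z * conj z)) = Real.pi := by
  simp only [cexp_neg_mul_conj]
  rw [integral_complex_ofReal]
  have h := Complex.integral_exp_neg_rpow (p := 2) (by norm_num)
  norm_num at h
  rw [h]

/-- Mean value property of entire functions for the Gaussian measure. -/
theorem integral_entire_mul_gaussian {G : ℂ → ℂ} (hG : Differentiable ℂ G)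
    (hint : Integrable fun z => G z * Complex.exp (-(z * conj z))) :
    ∫ z, G z * Complex.exp (-(z * conj z)) = Real.pi * G 0 := by
  set J : ℂ → ℂ := fun z => G z * Complex.exp (-(z * conj z)) with hJ
  have hJc : Continuous J := by
    have := hG.continuous
    have h2 := Complex.continuous_conj
    fun_prop
  -- Lebesgue measure and the Gaussian are rotation invariant. Averaging over `θ` replaces `G z` by
  -- its mean on a circle about `0`, which is `G 0`.
  set r : ℝ → ℂ → ℂ := fun θ z => rotation (Circle.exp θ) z with hr
  have hrmp : ∀ θ, MeasurePreserving (r θ) volume volume := fun θ =>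
    (rotation (Circle.exp θ)).measurePreserving
  have hre : ∀ θ, MeasurableEmbedding (r θ) := fun θ =>
    (rotation (Circle.exp θ)).toHomeomorph.measurableEmbedding
  have hr_eq : ∀ θ z, r θ z = Complex.exp (θ * Complex.I) * z := fun θ z => by
    simp [hr, rotation_apply]
  have hc2 : Continuous (Function.uncurry fun θ z => J (r θ z)) := by
    simp only [hr_eq]
    fun_prop
  have hprod : Integrable (Function.uncurry fun θ z => J (r θ z))
      ((volume.restrict (Ioc 0 (2 * Real.pi))).prod volume) := by
    rw [integrable_prod_iff hc2.aestronglyMeasurable]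
    refine ⟨Eventually.of_forall fun θ => (hrmp θ).integrable_comp_of_integrable hint, ?_⟩
    have : ∀ θ, ∫ z, ‖J (r θ z)‖ = ∫ z, ‖J z‖ := fun θ =>
      (hrmp θ).integral_comp (hre θ) fun z => ‖J z‖
    simp only [Function.uncurry_apply_pair, this]
    exact integrable_const _
  have hswap := integral_integral_swap hprod
  have h1 : ∀ θ, ∫ z, J (r θ z) = ∫ z, J z := fun θ => (hrmp θ).integral_comp (hre θ) J
  have h2 : ∀ z, ∫ θ in Ioc 0 (2 * Real.pi), J (r θ z) =
      (2 * Real.pi) * G 0 * Complex.exp (-(z * conj z)) := by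
    intro z
    have h3 : ∀ θ, J (r θ z) = G (circleMap 0 1 θ * z) * Complex.exp (-(z * conj z)) := by
      intro θ
      have h4 : ‖r θ z‖ = ‖z‖ := (rotation (Circle.exp θ)).norm_map z
      rw [hJ]
      simp only
      rw [cexp_neg_mul_conj, h4, ← cexp_neg_mul_conj, hr_eq]
      simp [circleMap]
    have h5 : Real.circleAverage (fun w => G (w * z)) 0 1 = G (0 * z) :=
      DiffContOnCl.circleAverage
        (Differentiable.diffContOnCl (by fun_prop : Differentiable ℂ fun w => G (w * z)))
    rw [Real.circleAverage_def, intervalIntegral.integral_of_le (by positivity)] at h5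
    simp only [h3]
    rw [integral_mul_const]
    congr 1
    rw [zero_mul] at h5
    rw [← h5, Complex.real_smul]
    push_cast
    rw [mul_inv_cancel_left₀ (by exact_mod_cast Real.two_pi_pos.ne')]
  simp only [h1, h2] at hswap
  rw [integral_const_mul, integral_cexp_neg_mul_conj, integral_const] at hswap
  simp only [MeasurableSet.univ, measureReal_restrict_apply, univ_inter, Real.volume_real_Ioc,
    sub_zero, Complex.real_smul] at hswap
  rw [max_eq_left (by positivity)] at hswap
  have hpi : (2 * Real.pi : ℂ) ≠ 0 := by
    exact_mod_cast Real.two_pi_pos.ne'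
  push_cast at hswap
  apply mul_left_cancel₀ hpi
  rw [hswap]
  ring

theorem norm_cexp_mul_conj_sub_le (a b : ℂ) :
    ‖Complex.exp (a * conj b - a * conj a)‖ ≤
      Real.exp (‖b‖ ^ 2 / 2) * Real.exp (-(1 / 2) * ‖a‖ ^ 2) := by
  rw [Complex.norm_exp, ← Real.exp_add]
  gcongr
  rw [Complex.sub_re, Complex.mul_conj, Complex.ofReal_re, Complex.normSq_eq_norm_sq]
  have h := (Complex.re_le_norm (a * conj b))
  rw [norm_mul, Complex.norm_conj] at h
  nlinarith [sq_nonneg (‖a‖ - ‖b‖)]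

theorem integrable_pow_mul_cexp (b : ℂ) (k : ℕ) :
    Integrable fun a : ℂ => a ^ k * Complex.exp (a * conj b - a * conj a) := by
  have h2 := Complex.continuous_conj
  refine ((integrable_add_norm_pow_mul_exp (c := 1 / 2) (by norm_num) 0 le_rfl k).const_mul
    (Real.exp (‖b‖ ^ 2 / 2))).mono' (by fun_prop) (Eventually.of_forall fun a => ?_)
  rw [norm_mul, norm_pow, zero_add]
  have := norm_cexp_mul_conj_sub_le a b
  calc _ ≤ ‖a‖ ^ k * (Real.exp (‖b‖ ^ 2 / 2) * Real.exp (-(1 / 2) * ‖a‖ ^ 2)) := by gcongr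
    _ = _ := by ring

theorem integral_mul_cexp_mul_conj_left (b : ℂ) :
    ∫ a : ℂ, a * Complex.exp (a * conj b - a * conj a) = 0 := by
  have h := integral_entire_mul_gaussian (G := fun a => a * Complex.exp (a * conj b))
    (by fun_prop) ?_
  · simp only [zero_mul, mul_zero] at h
    rw [← h]
    congr 1
    funext a
    rw [mul_assoc, ← Complex.exp_add, sub_eq_add_neg]
  · refine (integrable_pow_mul_cexp b 1).congr (Eventually.of_forall fun a => ?_)
    simp only
    rw [mul_assoc, ← Complex.exp_add, sub_eq_add_neg, pow_one]

theorem integrable_mul_cexp_mul_conj_right (b : ℂ) :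
    Integrable fun a : ℂ => a * Complex.exp (b * conj a - a * conj a) := by
  have h := (integrable_pow_mul_cexp b 1)
  refine h.norm.mono' ?_ (Eventually.of_forall fun a => ?_)
  · have h2 := Complex.continuous_conj
    fun_prop
  · rw [pow_one, norm_mul, norm_mul, Complex.norm_exp, Complex.norm_exp]
    simp [mul_comm]

theorem integral_mul_cexp_mul_conj_right (b : ℂ) :
    ∫ a : ℂ, a * Complex.exp (b * conj a - a * conj a) = Real.pi * b := by
  -- Translation by `b` removes the antiholomorphic exponential, leaving an entire function times
  -- the centred Gaussian.
  have hshift : ∀ a : ℂ, (a + b) * Complex.exp (b * conj (a + b) - (a + b) * conj (a + b)) =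
      (a + b) * Complex.exp (-(conj b * a)) * Complex.exp (-(a * conj a)) := by
    intro a
    rw [mul_assoc, ← Complex.exp_add, map_add]
    congr 2
    ring
  have h := integral_entire_mul_gaussian (G := fun a => (a + b) * Complex.exp (-(conj b * a)))
    (by fun_prop) ?_
  · rw [← integral_add_right_eq_self _ b]
    simp only [hshift]
    rw [h]
    simp
  · refine ((integrable_mul_cexp_mul_conj_right b).comp_add_right b).congr
      (Eventually.of_forall fun a => ?_)
    exact hshift a

/-- Write `Re a = (a + conj a) / 2`: the holomorphic half integrates to zero, while the other, by
conjugation, reproduces `conj b`. -/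
theorem integral_re_mul_cexp (b : ℂ) :
    ∫ a : ℂ, (a.re : ℂ) * Complex.exp (a * conj b - a * conj a) = Real.pi / 2 * conj b := by
  have h1 := integral_mul_cexp_mul_conj_left b
  have h2 := congrArg conj (integral_mul_cexp_mul_conj_right b)
  rw [← integral_conj] at h2
  have e2 : ∀ a : ℂ, conj (a * Complex.exp (b * conj a - a * conj a)) =
      conj a * Complex.exp (a * conj b - a * conj a) := by
    intro a
    rw [map_mul, ← Complex.exp_conj]
    simp [mul_comm]
  have i2 : Integrable fun a : ℂ => conj a * Complex.exp (a * conj b - a * conj a) := by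
    have := Complex.conjLIE.toContinuousLinearEquiv.toContinuousLinearMap.integrable_comp
      (integrable_mul_cexp_mul_conj_right b)
    refine this.congr (Eventually.of_forall fun a => ?_)
    exact e2 a
  have i1 : Integrable fun a : ℂ => a * Complex.exp (a * conj b - a * conj a) := by
    simpa using integrable_pow_mul_cexp b 1
  simp only [e2] at h2
  have e3 : ∀ a : ℂ, (a.re : ℂ) * Complex.exp (a * conj b - a * conj a) =
      (1 / 2) * (a * Complex.exp (a * conj b - a * conj a) +
        conj a * Complex.exp (a * conj b - a * conj a)) := by
    intro a
    rw [Complex.re_eq_add_conj]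
    ring
  simp only [e3]
  rw [integral_const_mul, integral_add i1 i2, h1, h2, map_mul, Complex.conj_ofReal]
  ring

/-- Since `Im b * conj b = -(i/2) (|b|² - conj b ²)` and `conj b ²` has Gaussian mean zero, only the
second moment `π` contributes. -/
theorem integral_im_mul_conj_mul_gaussian :
    ∫ b : ℂ, (b.im : ℂ) * conj b * Complex.exp (-(b * conj b)) = -(Real.pi / 2 * Complex.I) := by
  have h1 := integral_entire_mul_gaussian (G := fun a => a ^ 2) (by fun_prop)
    (by simpa using integrable_pow_mul_cexp 0 2)
  have h2 := congrArg conj h1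
  rw [← integral_conj] at h2
  have e2 : ∀ a : ℂ, conj (a ^ 2 * Complex.exp (-(a * conj a))) =
      conj a ^ 2 * Complex.exp (-(a * conj a)) := by
    intro a
    rw [map_mul, ← Complex.exp_conj]
    simp [mul_comm]
  have i2 : Integrable fun a : ℂ => conj a ^ 2 * Complex.exp (-(a * conj a)) := by
    have := Complex.conjLIE.toContinuousLinearEquiv.toContinuousLinearMap.integrable_comp
      (show Integrable fun a : ℂ => a ^ 2 * Complex.exp (-(a * conj a)) by
        simpa using integrable_pow_mul_cexp 0 2)
    refine this.congr (Eventually.of_forall fun a => ?_)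
    exact e2 a
  have e1 : ∀ a : ℂ, (a * conj a) * Complex.exp (-(a * conj a)) =
      ((‖a‖ ^ 2 * Real.exp (-‖a‖ ^ 2) : ℝ) : ℂ) := by
    intro a
    rw [cexp_neg_mul_conj, Complex.mul_conj, Complex.normSq_eq_norm_sq]
    push_cast
    rfl
  have i1 : Integrable fun a : ℂ => (a * conj a) * Complex.exp (-(a * conj a)) := by
    simp only [e1]
    refine Integrable.ofReal ?_
    have h := integrable_add_norm_pow_mul_exp one_pos 0 le_rfl 2
    simp only [zero_add, neg_mul, one_mul] at h
    exact h
  have h3 : ∫ a : ℂ, (a * conj a) * Complex.exp (-(a * conj a)) = Real.pi := by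
    simp only [e1]
    rw [integral_complex_ofReal]
    have h := Complex.integral_rpow_mul_exp_neg_rpow (p := 2) (q := 2) (by norm_num) (by norm_num)
    norm_num at h
    rw [h]
  simp only [e2] at h2
  have e3 : ∀ b : ℂ, (b.im : ℂ) * conj b * Complex.exp (-(b * conj b)) =
      (-(Complex.I / 2)) * ((b * conj b) * Complex.exp (-(b * conj b)) -
        conj b ^ 2 * Complex.exp (-(b * conj b))) := by
    intro b
    rw [Complex.im_eq_sub_conj]
    field_simp
    ring_nf
    simp
    ring
  simp only [e3]
  rw [integral_const_mul, integral_sub i1 i2, h3, h2]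
  simp
  ring

/-! ### Reproducing kernel and coherent states -/

/-- The integral kernel of the projection onto the Bargmann–Fock space. -/
noncomputable def fockKernel (z w : ℂ) : ℂ :=
  (Real.pi : ℂ)⁻¹ * Complex.exp (z * conj w - z * conj z / 2 - w * conj w / 2)

theorem continuous_fockKernel : Continuous fun p : ℂ × ℂ => fockKernel p.1 p.2 := by
  have := Complex.continuous_conj
  unfold fockKernel
  fun_prop

theorem conj_fockKernel (z w : ℂ) : conj (fockKernel z w) = fockKernel w z := by
  simp only [fockKernel, map_mul, map_inv₀, Complex.conj_ofReal, ← Complex.exp_conj]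
  congr 2
  simp only [map_sub, map_mul, map_div₀, Complex.conj_conj, Complex.conj_ofNat]
  ring

theorem norm_fockKernel (z w : ℂ) :
    ‖fockKernel z w‖ = Real.pi⁻¹ * Real.exp (-(1 / 2) * ‖z - w‖ ^ 2) := by
  rw [fockKernel, norm_mul, norm_inv, Complex.norm_real, Real.norm_of_nonneg Real.pi_pos.le,
    Complex.norm_exp, Complex.sq_norm, Complex.normSq_apply]
  congr 2
  simp
  ring

theorem gaussianWeight_eq (z : ℂ) : gaussianWeight z = Complex.exp (-(z * conj z) / 2) := by
  rw [gaussianWeight, Complex.mul_conj, Complex.normSq_eq_norm_sq]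
  push_cast
  rfl

theorem memLp_fockKernel (w : ℂ) : MemLp (fun z => fockKernel z w) 2 := by
  have hc : Continuous fun z => fockKernel z w :=
    continuous_fockKernel.comp (by fun_prop : Continuous fun z => (z, w))
  rw [memLp_two_iff_integrable_sq_norm hc.aestronglyMeasurable]
  have h := ((integrable_exp_neg_mul_norm_sq one_pos).comp_sub_right w).const_mul (Real.pi⁻¹ ^ 2)
  refine h.congr (Eventually.of_forall fun z => ?_)
  simp only [norm_fockKernel]
  rw [mul_pow, ← Real.exp_nat_mul]
  congr 2
  push_cast
  ring

/-- The coherent state at `w`, a reproducing vector of the Bargmann–Fock space. -/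
noncomputable def coherentState (w : ℂ) : L2C := (memLp_fockKernel w).toLp _

theorem coherentState_coeFn (w : ℂ) :
    (coherentState w : ℂ → ℂ) =ᵐ[volume] fun z => fockKernel z w :=
  (memLp_fockKernel w).coeFn_toLp

theorem coherentState_mem (w : ℂ) : coherentState w ∈ fockSpace := by
  refine ⟨fun z => (Real.pi : ℂ)⁻¹ * Complex.exp (z * conj w - w * conj w / 2), by fun_prop, ?_⟩
  filter_upwards [coherentState_coeFn w] with z hz
  rw [hz, gaussianWeight_eq, fockKernel, mul_assoc, ← Complex.exp_add]
  congr 2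
  ring

theorem inner_coherentState (w : ℂ) (φ : L2C) :
    ⟪coherentState w, φ⟫_ℂ = ∫ z, fockKernel w z * φ z := by
  rw [L2.inner_def]
  refine integral_congr_ae ?_
  filter_upwards [coherentState_coeFn w] with z hz
  rw [hz, RCLike.inner_apply, conj_fockKernel, mul_comm]

/-- The reproducing property of the coherent states. -/
theorem inner_coherentState_of_fock {φ : L2C} {F : ℂ → ℂ} (hF : Differentiable ℂ F)
    (hφ : (φ : ℂ → ℂ) =ᵐ[volume] fun z => F z * gaussianWeight z) (w : ℂ) :
    ⟪coherentState w, φ⟫_ℂ = F w * gaussianWeight w := by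
  have hint : Integrable fun z => fockKernel w z * (F z * gaussianWeight z) := by
    refine (L2.integrable_inner (𝕜 := ℂ) (coherentState w) φ).congr ?_
    filter_upwards [coherentState_coeFn w, hφ] with z hz h2
    rw [hz, h2, RCLike.inner_apply, conj_fockKernel, mul_comm]
  -- After recentring at `w`, the integrand is entire times a centred Gaussian, so the mean value
  -- property evaluates it at `ζ = 0`.
  have hshift : ∀ ζ, fockKernel w (ζ + w) * (F (ζ + w) * gaussianWeight (ζ + w)) =
      (Real.pi : ℂ)⁻¹ * gaussianWeight w *
        (F (ζ + w) * Complex.exp (-(ζ * conj w)) * Complex.exp (-(ζ * conj ζ))) := by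
    intro ζ
    rw [gaussianWeight_eq, gaussianWeight_eq, fockKernel, map_add]
    have : Complex.exp (w * (conj ζ + conj w) - w * conj w / 2 -
        (ζ + w) * (conj ζ + conj w) / 2) * Complex.exp (-((ζ + w) * (conj ζ + conj w)) / 2) =
        Complex.exp (-(w * conj w) / 2) * Complex.exp (-(ζ * conj w)) *
          Complex.exp (-(ζ * conj ζ)) := by
      rw [← Complex.exp_add, ← Complex.exp_add, ← Complex.exp_add]
      congr 1
      ring
    linear_combination (Real.pi : ℂ)⁻¹ * F (ζ + w) * this
  have hpi : (Real.pi : ℂ) ≠ 0 := by exact_mod_cast Real.pi_ne_zero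
  have hc : (Real.pi : ℂ)⁻¹ * gaussianWeight w ≠ 0 := by
    rw [gaussianWeight_eq]
    exact mul_ne_zero (inv_ne_zero hpi) (Complex.exp_ne_zero _)
  have h := integral_entire_mul_gaussian
    (G := fun ζ => F (ζ + w) * Complex.exp (-(ζ * conj w))) (by fun_prop) ?_
  · rw [inner_coherentState]
    calc _ = ∫ z, fockKernel w z * (F z * gaussianWeight z) := by
          refine integral_congr_ae ?_
          filter_upwards [hφ] with z hz
          rw [hz]
      _ = _ := by
          rw [← integral_add_right_eq_self _ w]
          simp only [hshift]
          rw [integral_const_mul, h]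
          simp
          field_simp
  · have h2 := hint.comp_add_right w
    simp only [hshift] at h2
    exact (integrable_const_mul_iff (IsUnit.mk0 _ hc) _).1 h2

theorem fockProjection_coherentState (w : ℂ) :
    fockProjection (coherentState w) = coherentState w :=
  Submodule.starProjection_eq_self_iff.2 (coherentState_mem w)

theorem inner_fockProjection_left (φ ψ : L2C) :
    ⟪fockProjection φ, ψ⟫_ℂ = ⟪φ, fockProjection ψ⟫_ℂ :=
  fockSpace.inner_starProjection_left_eq_right φ ψ

theorem fockProjection_fockProjection (φ : L2C) :
    fockProjection (fockProjection φ) = fockProjection φ :=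
  Submodule.starProjection_eq_self_iff.2 (Submodule.starProjection_apply_mem _ _)

theorem norm_fockProjection_le (φ : L2C) : ‖fockProjection φ‖ ≤ ‖φ‖ :=
  fockSpace.norm_starProjection_apply_le φ

theorem fockProjection_coeFn (φ : L2C) :
    (fockProjection φ : ℂ → ℂ) =ᵐ[volume] fun w => ⟪coherentState w, φ⟫_ℂ := by
  obtain ⟨F, hF, hφ⟩ := Submodule.starProjection_apply_mem fockSpace φ
  filter_upwards [hφ] with w hw
  rw [← fockProjection_coherentState, inner_fockProjection_left,
    show ⟪coherentState w, fockProjection φ⟫_ℂ = F w * gaussianWeight w from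
      inner_coherentState_of_fock hF hφ w]
  exact hw

/-! ### Hankel operators and the commutator -/

section Multiplication

variable {f g : Lp ℂ ∞ (volume : Measure ℂ)} {p q : ℂ → ℝ}

theorem inner_mulOp_mulOp_comm (hf : (f : ℂ → ℂ) =ᵐ[volume] fun z => (p z : ℂ))
    (hg : (g : ℂ → ℂ) =ᵐ[volume] fun z => (q z : ℂ)) (φ ψ : L2C) :
    ⟪mulOp f φ, mulOp g ψ⟫_ℂ = ⟪mulOp g φ, mulOp f ψ⟫_ℂ := by
  rw [L2.inner_def, L2.inner_def]
  refine integral_congr_ae ?_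
  filter_upwards [hf, hg, mulOp_coeFn f φ, mulOp_coeFn f ψ, mulOp_coeFn g φ, mulOp_coeFn g ψ]
    with z h1 h2 h3 h4 h5 h6
  simp only [h3, h4, h5, h6, h1, h2, RCLike.inner_apply, map_mul, Complex.conj_ofReal]
  ring

theorem inner_mulOp_left (hf : (f : ℂ → ℂ) =ᵐ[volume] fun z => (p z : ℂ)) (φ ψ : L2C) :
    ⟪mulOp f φ, ψ⟫_ℂ = ⟪φ, mulOp f ψ⟫_ℂ := by
  rw [L2.inner_def, L2.inner_def]
  refine integral_congr_ae ?_
  filter_upwards [hf, mulOp_coeFn f φ, mulOp_coeFn f ψ] with z h1 h3 h4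
  simp only [h3, h4, h1, RCLike.inner_apply, map_mul, Complex.conj_ofReal]
  ring

/-- The Hankel operator `(1 - P) f P` of the symbol `f`. -/
noncomputable def hankel (f : Lp ℂ ∞ (volume : Measure ℂ)) : L2C →L[ℂ] L2C :=
  mulOp f ∘L fockProjection - fockProjection ∘L mulOp f ∘L fockProjection

theorem inner_hankel (φ ψ : L2C) :
    ⟪hankel g φ, hankel f ψ⟫_ℂ = ⟪mulOp g (fockProjection φ), mulOp f (fockProjection ψ)⟫_ℂ -
      ⟪mulOp g (fockProjection φ), fockToeplitz f ψ⟫_ℂ := by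
  simp only [hankel, fockToeplitz, _root_.sub_apply, ContinuousLinearMap.comp_apply,
    inner_sub_left, inner_sub_right]
  simp only [inner_fockProjection_left, fockProjection_fockProjection]
  ring

/-- Both Hankel products contain `P f g P`, which cancels; what is left are the two Toeplitz
products. -/
theorem commutator_fockToeplitz_eq (hf : (f : ℂ → ℂ) =ᵐ[volume] fun z => (p z : ℂ))
    (hg : (g : ℂ → ℂ) =ᵐ[volume] fun z => (q z : ℂ)) :
    fockToeplitz f ∘L fockToeplitz g - fockToeplitz g ∘L fockToeplitz f =
      ContinuousLinearMap.adjoint (hankel g) ∘L hankel f -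
        ContinuousLinearMap.adjoint (hankel f) ∘L hankel g := by
  refine ContinuousLinearMap.ext fun y => ext_inner_left ℂ fun x => ?_
  have key : ∀ {f g : Lp ℂ ∞ (volume : Measure ℂ)} {p : ℂ → ℝ},
      (f : ℂ → ℂ) =ᵐ[volume] (fun z => (p z : ℂ)) →
      ⟪x, fockToeplitz f (fockToeplitz g y)⟫_ℂ =
        ⟪mulOp f (fockProjection x), fockToeplitz g y⟫_ℂ := by
    intro f g p hf
    rw [inner_mulOp_left hf, inner_fockProjection_left]
    simp only [fockToeplitz, ContinuousLinearMap.comp_apply, fockProjection_fockProjection]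
  simp only [_root_.sub_apply, ContinuousLinearMap.comp_apply, inner_sub_right,
    ContinuousLinearMap.adjoint_inner_right, inner_hankel, key hf, key hg]
  rw [inner_mulOp_mulOp_comm hf hg]
  ring

/-- The vectors representing, through inner products, the values of `hankel f φ`. -/
noncomputable def hankelVector (f : Lp ℂ ∞ (volume : Measure ℂ)) (p : ℂ → ℝ) (v : ℂ) : L2C :=
  fockProjection ((p v : ℂ) • coherentState v - mulOp f (coherentState v))

/-- At `v`, both `f P φ` and `P f P φ` are pairings of `P φ` with vectors, `p v • k_v` and `f k_v`
for the coherent state `k_v`; the difference localises to increments of `p`. -/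
theorem hankel_coeFn (hf : (f : ℂ → ℂ) =ᵐ[volume] fun z => (p z : ℂ)) (φ : L2C) :
    (hankel f φ : ℂ → ℂ) =ᵐ[volume] fun v => ⟪hankelVector f p v, φ⟫_ℂ := by
  filter_upwards [Lp.coeFn_sub (mulOp f (fockProjection φ))
    (fockProjection (mulOp f (fockProjection φ))), mulOp_coeFn f (fockProjection φ),
    fockProjection_coeFn (mulOp f (fockProjection φ)), fockProjection_coeFn φ, hf]
    with v h1 h2 h3 h4 h5
  have h6 : (hankel f φ : ℂ → ℂ) v = (mulOp f (fockProjection φ) -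
    fockProjection (mulOp f (fockProjection φ)) : L2C) v := rfl
  rw [h6, h1, Pi.sub_apply, h2, h3, h4, h5, hankelVector, inner_fockProjection_left,
    inner_sub_left, inner_smul_left, Complex.conj_ofReal, inner_mulOp_left hf,
    ← inner_fockProjection_left, fockProjection_coherentState]

theorem aestronglyMeasurable_inner_hankelVector
    (hf : (f : ℂ → ℂ) =ᵐ[volume] fun z => (p z : ℂ)) (φ : L2C) :
    AEStronglyMeasurable fun v => ⟪hankelVector f p v, φ⟫_ℂ :=
  (Lp.aestronglyMeasurable (hankel f φ)).congr (hankel_coeFn hf φ)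

theorem inner_adjoint_hankel (hf : (f : ℂ → ℂ) =ᵐ[volume] fun z => (p z : ℂ))
    (hg : (g : ℂ → ℂ) =ᵐ[volume] fun z => (q z : ℂ)) (x y : L2C) :
    ⟪x, (ContinuousLinearMap.adjoint (hankel f) ∘L hankel g) y⟫_ℂ =
      ∫ v, ⟪x, hankelVector f p v⟫_ℂ * ⟪hankelVector g q v, y⟫_ℂ := by
  rw [ContinuousLinearMap.comp_apply, ContinuousLinearMap.adjoint_inner_right, L2.inner_def]
  refine integral_congr_ae ?_
  filter_upwards [hankel_coeFn hf x, hankel_coeFn hg y] with v h1 h2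
  rw [h1, h2, RCLike.inner_apply, inner_conj_symm, mul_comm]

theorem smul_sub_mulOp_coeFn (hf : (f : ℂ → ℂ) =ᵐ[volume] fun z => (p z : ℂ)) (v : ℂ) :
    ((p v : ℂ) • coherentState v - mulOp f (coherentState v) : L2C) =ᵐ[volume]
      fun z => ((p v - p z : ℝ) : ℂ) * fockKernel z v := by
  filter_upwards [Lp.coeFn_sub ((p v : ℂ) • coherentState v) (mulOp f (coherentState v)),
    Lp.coeFn_smul (p v : ℂ) (coherentState v), mulOp_coeFn f (coherentState v),
    coherentState_coeFn v, hf] with z h1 h2 h3 h4 h5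
  rw [h1, Pi.sub_apply, h2, Pi.smul_apply, h3, h4, h5, smul_eq_mul]
  push_cast
  ring

theorem norm_hankelVector_sq_le (hf : (f : ℂ → ℂ) =ᵐ[volume] fun z => (p z : ℂ)) (v : ℂ) :
    ‖hankelVector f p v‖ ^ 2 ≤
      Real.pi⁻¹ ^ 2 * ∫ a, (p v - p (a + v)) ^ 2 * Real.exp (-1 * ‖a‖ ^ 2) := by
  set φ : L2C := (p v : ℂ) • coherentState v - mulOp f (coherentState v) with hφ
  have h1 : ‖hankelVector f p v‖ ^ 2 ≤ ‖φ‖ ^ 2 := by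
    gcongr
    exact norm_fockProjection_le φ
  refine h1.trans (le_of_eq ?_)
  have h2 : ((‖φ‖ ^ 2 : ℝ) : ℂ) = ⟪φ, φ⟫_ℂ := by
    rw [inner_self_eq_norm_sq_to_K]; norm_cast
  have h3 : ⟪φ, φ⟫_ℂ = ((∫ z, (p v - p z) ^ 2 * ‖fockKernel z v‖ ^ 2 : ℝ) : ℂ) := by
    rw [L2.inner_def, ← integral_complex_ofReal]
    refine integral_congr_ae ?_
    filter_upwards [smul_sub_mulOp_coeFn hf v] with z hz
    rw [hz, inner_self_eq_norm_sq_to_K, norm_mul, Complex.norm_real]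
    push_cast
    rw [mul_pow]
    norm_cast
    rw [Real.norm_eq_abs, sq_abs]
    norm_cast
  rw [h3] at h2
  rw [Complex.ofReal_injective h2, ← integral_add_right_eq_self _ v, ← integral_const_mul]
  refine integral_congr_ae (Eventually.of_forall fun a => ?_)
  simp only [norm_fockKernel, add_sub_cancel_right]
  rw [mul_pow, ← Real.exp_nat_mul]
  push_cast
  ring_nf

/-- The product of kernels around the triangle `v, u, w` is translation invariant, as the phases
cancel along a closed path. Thus `u = a + v`, `w = b + v` confines the dependence on `v` to the
symbols. -/
theorem inner_hankelVector (hf : (f : ℂ → ℂ) =ᵐ[volume] fun z => (p z : ℂ))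
    (hg : (g : ℂ → ℂ) =ᵐ[volume] fun z => (q z : ℂ)) (v : ℂ) :
    ⟪hankelVector f p v, hankelVector g q v⟫_ℂ = (Real.pi : ℂ)⁻¹ ^ 3 * ∫ a, ∫ b,
      ((p v - p (a + v)) * (q v - q (b + v)) : ℝ) *
        Complex.exp (a * conj b - a * conj a - b * conj b) := by
  have h1 : ⟪hankelVector f p v, hankelVector g q v⟫_ℂ =
      ∫ u, ∫ w, ((p v - p u) * (q v - q w) : ℝ) *
        (fockKernel v u * fockKernel u w * fockKernel w v) := by
    rw [hankelVector, inner_fockProjection_left, hankelVector, fockProjection_fockProjection,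
      L2.inner_def]
    refine integral_congr_ae ?_
    filter_upwards [smul_sub_mulOp_coeFn hf v, fockProjection_coeFn
      ((q v : ℂ) • coherentState v - mulOp g (coherentState v))] with u h1 h2
    rw [h1, h2, inner_coherentState, RCLike.inner_apply, map_mul, Complex.conj_ofReal,
      conj_fockKernel, mul_comm, ← integral_const_mul]
    refine integral_congr_ae ?_
    filter_upwards [smul_sub_mulOp_coeFn hg v] with w h3
    rw [h3]
    push_cast
    ring
  have h2 : ∀ a b, fockKernel v (a + v) * fockKernel (a + v) (b + v) * fockKernel (b + v) v =
      (Real.pi : ℂ)⁻¹ ^ 3 * Complex.exp (a * conj b - a * conj a - b * conj b) := by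
    intro a b
    have h3 : ∀ x y z s : ℂ, x + y + z = s →
        Complex.exp x * Complex.exp y * Complex.exp z = Complex.exp s := by
      intro x y z s h
      rw [← Complex.exp_add, ← Complex.exp_add, h]
    simp only [fockKernel]
    rw [← h3 (v * conj (a + v) - v * conj v / 2 - (a + v) * conj (a + v) / 2)
      ((a + v) * conj (b + v) - (a + v) * conj (a + v) / 2 - (b + v) * conj (b + v) / 2)
      ((b + v) * conj v - (b + v) * conj (b + v) / 2 - v * conj v / 2)
      (a * conj b - a * conj a - b * conj b) (by simp only [map_add]; ring)]
    ring
  rw [h1, ← integral_add_right_eq_self _ v, ← integral_const_mul]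
  refine integral_congr_ae (Eventually.of_forall fun a => ?_)
  simp only
  rw [← integral_add_right_eq_self _ v, ← integral_const_mul]
  refine integral_congr_ae (Eventually.of_forall fun b => ?_)
  simp only [h2]
  ring

end Multiplication

/-! ### Increments of switch functions -/

section Switch

variable {Λ : ℝ → ℝ}

/-- The increments of a switch function are localised near its transition interval. -/
theorem IsSwitchFunction.exists_increment_bound (h : IsSwitchFunction Λ) :
    ∃ R : ℝ, 0 ≤ R ∧ ∀ s t, (1 + s ^ 2) * |Λ s - Λ (t + s)| ≤ (R + |t|) ^ 2 := by
  obtain ⟨c, d, -, h0, h1⟩ := h.exists_interval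
  -- For `|s| ≤ |c| + |d| + |t|` the right side dominates `1 + s²`; for larger `|s|`, `s` and `t +
  -- s` lie on the same side of `[c, d]` and the increment vanishes.
  refine ⟨1 + |c| + |d|, by positivity, fun s t => ?_⟩
  have hle : |Λ s - Λ (t + s)| ≤ 1 := by
    have h2 := h.mem_Icc s
    have h3 := h.mem_Icc (t + s)
    rw [abs_le]
    constructor <;> linarith [h2.1, h2.2, h3.1, h3.2]
  by_cases hs : |s| ≤ |c| + |d| + |t|
  · have h2 : 1 + s ^ 2 ≤ (1 + |c| + |d| + |t|) ^ 2 := by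
      rw [← sq_abs s]
      nlinarith [abs_nonneg s, abs_nonneg c, abs_nonneg d, abs_nonneg t]
    exact (mul_le_of_le_one_right (by positivity) hle).trans h2
  · have h2 : Λ s = Λ (t + s) := by
      rw [not_le] at hs
      rcases le_total 0 s with h3 | h3
      · rw [abs_of_nonneg h3] at hs
        have := le_abs_self d
        have := neg_abs_le t
        rw [h1 s (by linarith [abs_nonneg c, abs_nonneg t]),
          h1 (t + s) (by linarith [abs_nonneg c])]
      · rw [abs_of_nonpos h3] at hs
        have := neg_abs_le c
        have := le_abs_self t
        rw [h0 s (by linarith [abs_nonneg d, abs_nonneg t]),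
          h0 (t + s) (by linarith [abs_nonneg d])]
    rw [h2]
    simp
    positivity

theorem IsSwitchFunction.integrable_increment (h : IsSwitchFunction Λ) (t : ℝ) :
    Integrable fun s => Λ s - Λ (t + s) := by
  obtain ⟨R, hR, hb⟩ := h.exists_increment_bound
  have := h.measurable
  refine (integrable_inv_one_add_sq.const_mul ((R + |t|) ^ 2)).mono'
    (by fun_prop) (Eventually.of_forall fun s => ?_)
  rw [Real.norm_eq_abs, ← div_eq_mul_inv, le_div_iff₀ (by positivity), mul_comm]
  exact hb s t

theorem IsSwitchFunction.integral_increment (h : IsSwitchFunction Λ) (t : ℝ) :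
    ∫ s, (Λ s - Λ (t + s)) = -t := by
  obtain ⟨c, d, hcd, h0, h1⟩ := h.exists_interval
  set A := c - |t| - 1 with hA
  set B := d + |t| + 1 with hB
  have ht := abs_nonneg t
  have ht1 := le_abs_self t
  have ht2 := neg_abs_le t
  have hAB : A ≤ B := by linarith
  have hi : ∀ a b, IntervalIntegrable Λ volume a b := fun a b => h.monotone.intervalIntegrable
  have hsupp : Function.support (fun s => Λ s - Λ (t + s)) ⊆ Ioc A B := by
    intro s hs
    by_contra hs'
    apply hs
    simp only [mem_Ioc, not_and_or, not_lt, not_le] at hs'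
    rcases hs' with hs' | hs'
    · simp only
      rw [h0 s (by linarith), h0 (t + s) (by linarith), sub_zero]
    · simp only
      rw [h1 s (by linarith), h1 (t + s) (by linarith), sub_self]
  -- The integral becomes `∫ Λ` over `[A, t + A]` minus `∫ Λ` over `[B, t + B]`. The margins `|t| +
  -- 1` make `Λ` equal to `0` on the first and `1` on the second.
  rw [← intervalIntegral.integral_eq_integral_of_support_subset hsupp,
    intervalIntegral.integral_sub (hi _ _), intervalIntegral.integral_comp_add_left,
    intervalIntegral.integral_interval_sub_interval_comm (hi _ _) (hi _ _) (hi _ _)]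
  · have e0 : ∫ x in A..(t + A), Λ x = ∫ x in A..(t + A), (0 : ℝ) := by
      refine intervalIntegral.integral_congr fun x hx => h0 x ?_
      have := (mem_uIcc.1 hx)
      rcases this with h | h <;> linarith [h.1, h.2]
    have e1 : ∫ x in B..(t + B), Λ x = ∫ x in B..(t + B), (1 : ℝ) := by
      refine intervalIntegral.integral_congr fun x hx => h1 x ?_
      have := (mem_uIcc.1 hx)
      rcases this with h | h <;> linarith [h.1, h.2]
    rw [e0, e1]
    simp
  · exact Monotone.intervalIntegrable fun x y hxy => h.monotone (by linarith)

/-- By monotonicity the increment has constant sign in `s`. This gives the exact `L¹` norm used for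
Fubini. -/
theorem IsSwitchFunction.integral_abs_increment (h : IsSwitchFunction Λ) (t : ℝ) :
    ∫ s, |Λ s - Λ (t + s)| = |t| := by
  rcases le_total 0 t with ht | ht
  · have : ∀ s, |Λ s - Λ (t + s)| = -(Λ s - Λ (t + s)) := fun s =>
      abs_of_nonpos (by linarith [h.monotone (show s ≤ t + s by linarith)])
    simp only [this]
    rw [integral_neg, h.integral_increment, neg_neg, abs_of_nonneg ht]
  · have : ∀ s, |Λ s - Λ (t + s)| = Λ s - Λ (t + s) := fun s =>
      abs_of_nonneg (by linarith [h.monotone (show t + s ≤ s by linarith)])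
    simp only [this]
    rw [h.integral_increment, abs_of_nonpos ht]

/-- Decay of the representing vectors of the Hankel operator away from the transition line. -/
theorem IsSwitchFunction.exists_norm_hankelVector_le (h : IsSwitchFunction Λ)
    {f : Lp ℂ ∞ (volume : Measure ℂ)} {x : ℂ → ℝ} (hx : ∀ a b, x (a + b) = x a + x b) (hx1 : ∀ a, |x a| ≤ ‖a‖)
    (hf : (f : ℂ → ℂ) =ᵐ[volume] fun z => (Λ (x z) : ℂ)) :
    ∃ C : ℝ, 0 ≤ C ∧ ∀ v, ‖hankelVector f (fun z => Λ (x z)) v‖ ≤ C * (1 + x v ^ 2)⁻¹ := by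
  obtain ⟨R, hR, hb⟩ := h.exists_increment_bound
  -- The fourth power is the square of the increment bound `(R + |t|) ^ 2`; the moment does not
  -- depend on `v`.
  set K : ℝ := Real.pi⁻¹ ^ 2 * ∫ a : ℂ, (R + ‖a‖) ^ 4 * Real.exp (-1 * ‖a‖ ^ 2) with hK
  have hK0 : 0 ≤ K := mul_nonneg (by positivity) (integral_nonneg fun a => by positivity)
  refine ⟨√K, Real.sqrt_nonneg _, fun v => ?_⟩
  rw [← div_eq_mul_inv, le_div_iff₀ (by positivity)]
  refine Real.le_sqrt_of_sq_le ?_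
  rw [mul_pow]
  refine (mul_le_mul_of_nonneg_right (norm_hankelVector_sq_le hf v) (by positivity)).trans ?_
  rw [hK, mul_assoc, ← integral_mul_const]
  refine mul_le_mul_of_nonneg_left ?_ (by positivity)
  have hint := integrable_add_norm_pow_mul_exp one_pos R hR 4
  have hpt : ∀ a : ℂ, (Λ (x v) - Λ (x (a + v))) ^ 2 * Real.exp (-1 * ‖a‖ ^ 2) *
      (1 + x v ^ 2) ^ 2 ≤ (R + ‖a‖) ^ 4 * Real.exp (-1 * ‖a‖ ^ 2) := by
    intro a
    have h1 := hb (x v) (x a)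
    rw [← hx] at h1
    have h2 : (1 + x v ^ 2) * |Λ (x v) - Λ (x (a + v))| ≤ (R + ‖a‖) ^ 2 :=
      h1.trans (by have := hx1 a; gcongr)
    have h3 := pow_le_pow_left₀ (by positivity) h2 2
    rw [mul_pow, sq_abs] at h3
    calc _ = (1 + x v ^ 2) ^ 2 * (Λ (x v) - Λ (x (a + v))) ^ 2 * Real.exp (-1 * ‖a‖ ^ 2) := by ring
      _ ≤ ((R + ‖a‖) ^ 2) ^ 2 * Real.exp (-1 * ‖a‖ ^ 2) := by gcongr
      _ = _ := by ring
  have hm := h.measurable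
  refine integral_mono_of_nonneg (Eventually.of_forall fun a => by positivity) hint
    (Eventually.of_forall hpt)

end Switch

theorem integrable_mul_re_im {𝕜 : Type*} [RCLike 𝕜] {u v : ℝ → 𝕜} (hu : Integrable u)
    (hv : Integrable v) : Integrable fun z : ℂ => u z.re * v z.im :=
  Complex.volume_preserving_equiv_real_prod.integrable_comp_of_integrable (hu.mul_prod hv)

theorem integral_mul_re_im {𝕜 : Type*} [RCLike 𝕜] (u v : ℝ → 𝕜) :
    ∫ z : ℂ, u z.re * v z.im = (∫ s, u s) * ∫ t, v t := by
  rw [← integral_prod_mul, ← Measure.volume_eq_prod]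
  exact Complex.volume_preserving_equiv_real_prod.integral_comp
    Complex.measurableEquivRealProd.measurableEmbedding fun p : ℝ × ℝ => u p.1 * v p.2

/-! ### Evaluation of the trace integral -/

section Trace

variable {Λ₁ Λ₂ : ℝ → ℝ}

/-- The gauge-invariant triangle kernel, with one vertex at the origin. -/
noncomputable def triangleKernel (a b : ℂ) : ℂ :=
  Complex.exp (a * conj b - a * conj a - b * conj b)

theorem continuous_triangleKernel : Continuous fun q : ℂ × ℂ => triangleKernel q.1 q.2 := by
  have := Complex.continuous_conj
  unfold triangleKernel
  fun_prop

theorem norm_triangleKernel_le (a b : ℂ) :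
    ‖triangleKernel a b‖ ≤
      Real.exp (-(1 / 2) * ‖a‖ ^ 2) * Real.exp (-(1 / 2) * ‖b‖ ^ 2) := by
  rw [triangleKernel, sub_eq_add_neg _ (b * conj b), Complex.exp_add, norm_mul,
    cexp_neg_mul_conj, Complex.norm_real, Real.norm_of_nonneg (Real.exp_pos _).le]
  refine (mul_le_mul_of_nonneg_right (norm_cexp_mul_conj_sub_le a b) (Real.exp_pos _).le).trans
    (le_of_eq ?_)
  rw [← Real.exp_add, ← Real.exp_add, ← Real.exp_add]
  congr 1
  ring

theorem integrable_mul_triangleKernel {u : ℂ × ℂ → ℂ} (hu : Measurable u)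
    (hb : ∀ q, ‖u q‖ ≤ (1 + ‖q.1‖) ^ 1 * (1 + ‖q.2‖) ^ 1) :
    Integrable fun q => u q * triangleKernel q.1 q.2 := by
  have h := integrable_add_norm_pow_mul_exp (c := 1 / 2) (by norm_num) 1 zero_le_one 1
  have h2 := h.mul_prod h
  refine Integrable.mono' h2
    (hu.aestronglyMeasurable.mul continuous_triangleKernel.aestronglyMeasurable)
    (Eventually.of_forall fun q => ?_)
  rw [norm_mul]
  calc _ ≤ ((1 + ‖q.1‖) ^ 1 * (1 + ‖q.2‖) ^ 1) *
        (Real.exp (-(1 / 2) * ‖q.1‖ ^ 2) * Real.exp (-(1 / 2) * ‖q.2‖ ^ 2)) :=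
        mul_le_mul (hb q) (norm_triangleKernel_le _ _) (norm_nonneg _) (by positivity)
    _ = _ := by ring

/-- Integrating over `a` first leaves `π/2` times the moment of `integral_im_mul_conj_mul_gaussian`.
-/
theorem integral_re_im_mul_triangleKernel :
    ∫ q : ℂ × ℂ, ((q.1.re * q.2.im : ℝ) : ℂ) * triangleKernel q.1 q.2 =
      -((Real.pi : ℂ) ^ 2 / 4 * Complex.I) := by
  have hint : Integrable fun q : ℂ × ℂ =>
      ((q.1.re * q.2.im : ℝ) : ℂ) * triangleKernel q.1 q.2 := by
    refine integrable_mul_triangleKernel (by fun_prop) fun q => ?_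
    rw [Complex.norm_real, norm_mul, pow_one, pow_one]
    have h1 := Complex.abs_re_le_norm q.1
    have h2 := Complex.abs_im_le_norm q.2
    simp only [Real.norm_eq_abs]
    gcongr <;> linarith
  rw [Measure.volume_eq_prod, integral_prod_symm _ hint]
  have h : ∀ b : ℂ, ∫ a : ℂ, ((a.re * b.im : ℝ) : ℂ) * triangleKernel a b =
      (Real.pi / 2) * ((b.im : ℂ) * conj b * Complex.exp (-(b * conj b))) := by
    intro b
    have e : ∀ a : ℂ, ((a.re * b.im : ℝ) : ℂ) * triangleKernel a b =
        ((b.im : ℂ) * Complex.exp (-(b * conj b))) *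
          ((a.re : ℂ) * Complex.exp (a * conj b - a * conj a)) := by
      intro a
      rw [triangleKernel, sub_eq_add_neg _ (b * conj b), Complex.exp_add]
      push_cast
      ring
    simp only [e]
    rw [integral_const_mul, integral_re_mul_cexp]
    ring
  simp only [h]
  rw [integral_const_mul, integral_im_mul_conj_mul_gaussian]
  ring

/-- Integrating over `v` first separates into its two coordinates and gives `(-a.re) * (-b.im)`,
whatever the switch functions. -/
theorem integral_increments_mul_triangleKernel (h₁ : IsSwitchFunction Λ₁)
    (h₂ : IsSwitchFunction Λ₂) :
    ∫ v : ℂ, ∫ a : ℂ, ∫ b : ℂ,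
      ((Λ₁ v.re - Λ₁ (a + v).re) * (Λ₂ v.im - Λ₂ (b + v).im) : ℝ) *
        triangleKernel a b = -((Real.pi : ℂ) ^ 2 / 4 * Complex.I) := by
  set w : ℂ → ℂ × ℂ → ℝ := fun v q =>
    (Λ₁ v.re - Λ₁ (q.1.re + v.re)) * (Λ₂ v.im - Λ₂ (q.2.im + v.im)) with hw
  set Φ : ℂ → ℂ × ℂ → ℂ := fun v q => (w v q : ℂ) * triangleKernel q.1 q.2 with hΦ
  have hm₁ := h₁.measurable
  have hm₂ := h₂.measurable
  have hwm : Measurable (Function.uncurry w) := by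
    simp only [hw, Function.uncurry_def]
    fun_prop
  have hΦm : Measurable (Function.uncurry Φ) := by
    have h1 : Measurable fun p : ℂ × ℂ × ℂ => triangleKernel p.2.1 p.2.2 :=
      continuous_triangleKernel.measurable.comp measurable_snd
    exact (Complex.measurable_ofReal.comp hwm).mul h1
  have hinner : ∀ q, Integrable fun v => w v q := fun q =>
    integrable_mul_re_im (h₁.integrable_increment q.1.re) (h₂.integrable_increment q.2.im)
  have hsum : ∀ q, ∫ v, w v q = q.1.re * q.2.im := by
    intro q
    have h := integral_mul_re_im (fun s => Λ₁ s - Λ₁ (q.1.re + s))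
      (fun s => Λ₂ s - Λ₂ (q.2.im + s))
    rw [h₁.integral_increment, h₂.integral_increment, neg_mul_neg] at h
    exact h
  have hnorm : ∀ q, ∫ v, ‖Φ v q‖ = |q.1.re| * |q.2.im| * ‖triangleKernel q.1 q.2‖ := by
    intro q
    have h := integral_mul_re_im (fun s => |Λ₁ s - Λ₁ (q.1.re + s)|)
      (fun s => |Λ₂ s - Λ₂ (q.2.im + s)|)
    rw [h₁.integral_abs_increment, h₂.integral_abs_increment] at h
    simp only [hΦ, hw, norm_mul, Complex.norm_real, Real.norm_eq_abs]
    rw [integral_mul_const, h]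
  -- Absolute integrability for Fubini: the `L¹` norm in `v` is `|a.re| |b.im|` times the modulus of
  -- the kernel, which is Gaussian-integrable.
  have hprod : Integrable (Function.uncurry Φ) (volume.prod volume) := by
    rw [integrable_prod_iff' hΦm.aestronglyMeasurable]
    refine ⟨Eventually.of_forall fun q =>
      (hinner q).ofReal.mul_const (triangleKernel q.1 q.2), ?_⟩
    simp only [Function.uncurry_apply_pair, hnorm]
    have h := (integrable_mul_triangleKernel
      (u := fun q => ((q.1.re * q.2.im : ℝ) : ℂ)) (by fun_prop) fun q => ?_).norm
    · refine h.congr (Eventually.of_forall fun q => ?_)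
      simp only [norm_mul, Complex.norm_real, Real.norm_eq_abs]
    · rw [Complex.norm_real, norm_mul, pow_one, pow_one]
      have h1 := Complex.abs_re_le_norm q.1
      have h2 := Complex.abs_im_le_norm q.2
      simp only [Real.norm_eq_abs]
      gcongr <;> linarith
  have hv : ∀ v : ℂ, ∫ a : ℂ, ∫ b : ℂ,
      ((Λ₁ v.re - Λ₁ (a + v).re) * (Λ₂ v.im - Λ₂ (b + v).im) : ℝ) *
        triangleKernel a b = ∫ q, Φ v q := by
    intro v
    have hi : Integrable (Φ v) := by
      refine integrable_mul_triangleKernel (by fun_prop) fun q => ?_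
      have e1 : ‖Λ₁ v.re - Λ₁ (q.1.re + v.re)‖ ≤ 1 := by
        have h2 := h₁.mem_Icc v.re
        have h3 := h₁.mem_Icc (q.1.re + v.re)
        rw [Real.norm_eq_abs, abs_le]
        constructor <;> linarith [h2.1, h2.2, h3.1, h3.2]
      have e2 : ‖Λ₂ v.im - Λ₂ (q.2.im + v.im)‖ ≤ 1 := by
        have h2 := h₂.mem_Icc v.im
        have h3 := h₂.mem_Icc (q.2.im + v.im)
        rw [Real.norm_eq_abs, abs_le]
        constructor <;> linarith [h2.1, h2.2, h3.1, h3.2]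
      rw [Complex.norm_real, norm_mul, pow_one, pow_one]
      have := norm_nonneg q.1
      have := norm_nonneg q.2
      gcongr <;> linarith
    rw [Measure.volume_eq_prod, integral_prod _ hi]
    rfl
  simp only [hv]
  rw [integral_integral_swap hprod, ← integral_re_im_mul_triangleKernel]
  refine integral_congr_ae (Eventually.of_forall fun q => ?_)
  simp only [hΦ]
  rw [integral_mul_const, integral_complex_ofReal, hsum]

end Trace

/-- The commutator of the Fock–Toeplitz operators of two transversal switch functions is trace
class, with trace `1 / (2πi)`. -/
theorem hasTrace_commutator_fockToeplitz {Λ₁ Λ₂ : ℝ → ℝ}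
    (h₁ : IsSwitchFunction Λ₁) (h₂ : IsSwitchFunction Λ₂) :
    HasTrace
      (fockToeplitz h₁.fst ∘L fockToeplitz h₂.snd -
        fockToeplitz h₂.snd ∘L fockToeplitz h₁.fst)
      (1 / (2 * (Real.pi : ℂ) * Complex.I)) := by
  set p : ℂ → ℝ := fun z => Λ₁ z.re
  set q : ℂ → ℝ := fun z => Λ₂ z.im
  have hf : (h₁.fst : ℂ → ℂ) =ᵐ[volume] fun z => (p z : ℂ) := MemLp.coeFn_toLp _
  have hg : (h₂.snd : ℂ → ℂ) =ᵐ[volume] fun z => (q z : ℂ) := MemLp.coeFn_toLp _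
  set α := hankelVector h₁.fst p
  set β := hankelVector h₂.snd q
  have hα := aestronglyMeasurable_inner_hankelVector hf
  have hβ := aestronglyMeasurable_inner_hankelVector hg
  have h12 := inner_adjoint_hankel hf hg
  have h21 := inner_adjoint_hankel hg hf
  obtain ⟨C, hC, hCα⟩ := h₁.exists_norm_hankelVector_le Complex.add_re
    Complex.abs_re_le_norm hf
  obtain ⟨D, hD, hDβ⟩ := h₂.exists_norm_hankelVector_le Complex.add_im
    Complex.abs_im_le_norm hg
  -- Each Hankel vector decays in one coordinate only; transversality makes the product integrable
  -- on the plane.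
  set m : ℂ → ℝ := fun v => (C * (1 + v.re ^ 2)⁻¹) * (D * (1 + v.im ^ 2)⁻¹)
  have hm : Integrable m := integrable_mul_re_im
    (u := fun s => C * (1 + s ^ 2)⁻¹) (v := fun s => D * (1 + s ^ 2)⁻¹)
    (integrable_inv_one_add_sq.const_mul C) (integrable_inv_one_add_sq.const_mul D)
  have hαβ : ∀ v, ‖α v‖ * ‖β v‖ ≤ m v := fun v =>
    mul_le_mul (hCα v) (hDβ v) (norm_nonneg _) (by positivity)
  have hβα : ∀ v, ‖β v‖ * ‖α v‖ ≤ m v := fun v => by rw [mul_comm]; exact hαβ v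
  have hsep : TopologicalSpace.SeparableSpace L2C := by
    have : Fact ((2 : ℝ≥0∞) ≠ ∞) := ⟨by norm_num⟩
    infer_instance
  have hpi : (Real.pi : ℂ) ≠ 0 := by exact_mod_cast Real.pi_ne_zero
  -- The factor `π⁻³` from the three kernels meets the moment `-i π² / 4`.
  have hI : ∫ v, ⟪α v, β v⟫_ℂ = -(Complex.I / (4 * Real.pi)) := by
    have h : ∀ v, ⟪α v, β v⟫_ℂ = _ := inner_hankelVector hf hg
    simp only [h]
    rw [integral_const_mul]
    have h3 := integral_increments_mul_triangleKernel h₁ h₂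
    simp only [triangleKernel] at h3
    rw [h3]
    field_simp
  have hJ : ∫ v, ⟪β v, α v⟫_ℂ = Complex.I / (4 * Real.pi) := by
    have h : ∀ v, ⟪β v, α v⟫_ℂ = starRingEnd ℂ ⟪α v, β v⟫_ℂ := fun v => (inner_conj_symm _ _).symm
    simp only [h]
    rw [integral_conj, hI]
    simp only [map_neg, map_div₀, map_mul, Complex.conj_I, Complex.conj_ofReal,
      Complex.conj_ofNat]
    ring
  rw [commutator_fockToeplitz_eq hf hg]
  refine ⟨((nuclearBound_of_integral hβ hα hm hβα h21).sub
    (nuclearBound_of_integral hα hβ hm hαβ h12)).isTraceClass, fun ι e => ?_⟩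
  have hs := (hasSum_of_integral hβ hα hm hβα h21 e).sub (hasSum_of_integral hα hβ hm hαβ h12 e)
  simp only [_root_.sub_apply, inner_sub_right]
  have hval : (1 / (2 * (Real.pi : ℂ) * Complex.I)) =
      (∫ v, ⟪α v, β v⟫_ℂ) - ∫ v, ⟪β v, α v⟫_ℂ := by
    rw [hI, hJ]
    field_simp
    rw [Complex.I_sq]
    norm_num
  rw [hval]
  exact hs

end FockToeplitz


theorem mainTheorem1 (Λ₁ Λ₂ : ℝ → ℝ)
    (h₁ : FockToeplitz.IsSwitchFunction Λ₁) (h₂ : FockToeplitz.IsSwitchFunction Λ₂) :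
    FockToeplitz.HasTrace
      (FockToeplitz.fockToeplitz h₁.fst ∘L FockToeplitz.fockToeplitz h₂.snd -
        FockToeplitz.fockToeplitz h₂.snd ∘L FockToeplitz.fockToeplitz h₁.fst)
      (1 / (2 * (Real.pi : ℂ) * Complex.I)) :=
  FockToeplitz.hasTrace_commutator_fockToeplitz h₁ h₂
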